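/- Let $R_0$ be the monoid algebra over $\mathbb{F}_2$ of the monoid of all formal monomials $X^aY^bZ^c\prod_{i\ge 1}T_i^{t_i}$ with $a,b,c,t_i\in\mathbb{Q}_{\ge 0}$ (infinitely many $t_i$ may be nonzero), multiplied by adding exponents. Let $J=\{\prod_{i\ge 1}T_i^{t_i} : t_i\in\mathbb{Q}_{\ge 0}\}$, and let $$R=\mathbb{F}_2\big[\{X^\alpha,Y^\alpha,Z^\alpha : \alpha\in\mathbb{Q}_{\ge 0}\}\cup\{X^\alpha T,Y^\alpha T,Z^\alpha T : \alpha\in\mathbb{Q}_{>0},\ T\in J\}\big]\subseteq R_0 .$$ A polynomial over an integral domain $D$ is *primitive* if the ideal generated by its coefficients is not contained in any proper principal ideal of $D$, and $D$ is a *GL-domain* if the product of any two primitive polynomials over $D$ is primitive. A common divisor $d$ of a set $S$ is a *maximal common divisor* (MCD) of $S$ if every common divisor $d'$ of $S$ with $d\mid d'$ is an associate of $d$; $D$ is *MCD-finite* if every nonempty finite set of nonzero elements of $D$ has only finitely many MCDs up to associates. **Proposition.** The ring $R$ is an integral domain and a GL-domain, and it is not MCD-finite. Specifically, the elements $s_y=XY\prod_{i\ge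 1}T_i$ and $s_z=XZ\prod_{i\ge 1}T_i$ of $R$ have infinitely many pairwise non-associate maximal common divisors in $R$. -/

import Mathlib

namespace GLExample

/-- An integral domain `D` is a GL-domain if the product of two primitive polynomials over `D` is
primitive. Here `f.IsPrimitive` says that every `r : D` with `C r ∣ f` is a unit, i.e. the ideal
generated by the coefficients of `f` is not contained in any proper principal ideal. -/
def IsGLDomain (D : Type*) [CommRing D] : Prop :=
  IsDomain D ∧ ∀ f g : Polynomial D, f.IsPrimitive → g.IsPrimitive → (f * g).IsPrimitive

/-- `d` is a maximal common divisor of `S`. -/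
def IsMCD {M : Type*} [CommMonoid M] (S : Set M) (d : M) : Prop :=
  (∀ s ∈ S, d ∣ s) ∧ ∀ d' : M, (∀ s ∈ S, d' ∣ s) → d ∣ d' → Associated d d'

/-- The set of associate classes of maximal common divisors of `S`. -/
def mcdClasses {M : Type*} [CommMonoid M] (S : Set M) : Set (Associates M) :=
  {c | ∃ d : M, IsMCD S d ∧ Associates.mk d = c}

/-- A domain `D` is MCD-finite if every nonempty finite set of nonzero elements has only finitely
many maximal common divisors up to associates. -/
def IsMCDFinite (D : Type*) [CommRing D] : Prop :=
  ∀ S : Set D, S.Finite → S.Nonempty → (0 : D) ∉ S → (mcdClasses S).Finite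

/-- The indeterminates `X, Y, Z, T₁, T₂, T₃, …`. -/
inductive Var : Type
  | X : Var
  | Y : Var
  | Z : Var
  | T (i : ℕ+) : Var

/-- The exponent vector of `X ^ a * Y ^ b * Z ^ c * ∏ i, T i ^ t i`. -/
def expo (a b c : ℚ≥0) (t : ℕ+ → ℚ≥0) : Var → ℚ≥0
  | Var.X => a
  | Var.Y => b
  | Var.Z => c
  | Var.T i => t i

/-- The monoid algebra over `𝔽₂` of all (possibly infinite) formal products of powers of the
indeterminates with nonnegative rational exponents. -/
abbrev R₀ : Type := AddMonoidAlgebra (ZMod 2) (Var → ℚ≥0)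

/-- The monomial `X ^ a * Y ^ b * Z ^ c * ∏ i, T i ^ t i` of `R₀`. -/
noncomputable def mono (a b c : ℚ≥0) (t : ℕ+ → ℚ≥0) : R₀ :=
  AddMonoidAlgebra.single (expo a b c t) 1

theorem mono_mul (a b c a' b' c' : ℚ≥0) (t t' : ℕ+ → ℚ≥0) :
    mono a b c t * mono a' b' c' t' = mono (a + a') (b + b') (c + c') (t + t') := by
  have h : expo a b c t + expo a' b' c' t' = expo (a + a') (b + b') (c + c') (t + t') := by
    funext v
    cases v <;> rfl
  simp [mono, AddMonoidAlgebra.single_mul_single, h]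

/-- The generators `X ^ α, Y ^ α, Z ^ α` with `α ≥ 0`. -/
def pureGenerators : Set R₀ :=
  {f | ∃ α : ℚ≥0, f = mono α 0 0 0 ∨ f = mono 0 α 0 0 ∨ f = mono 0 0 α 0}

/-- The generators `X ^ α * T, Y ^ α * T, Z ^ α * T` with `α > 0` and `T = ∏ i, T i ^ t i`. -/
def mixedGenerators : Set R₀ :=
  {f | ∃ (α : ℚ≥0) (t : ℕ+ → ℚ≥0), 0 < α ∧
    (f = mono α 0 0 t ∨ f = mono 0 α 0 t ∨ f = mono 0 0 α t)}

/-- The subring `R` of `R₀` generated over `𝔽₂` by these monomials. -/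
noncomputable def R : Subalgebra (ZMod 2) R₀ :=
  Algebra.adjoin (ZMod 2) (pureGenerators ∪ mixedGenerators)

theorem sY_mem : mono 1 1 0 1 ∈ R := by
  have h : mono 1 1 0 1 = mono 1 0 0 0 * mono 0 1 0 1 := by simp [mono_mul]
  rw [h]
  exact mul_mem (Algebra.subset_adjoin (Or.inl ⟨1, Or.inl rfl⟩))
    (Algebra.subset_adjoin (Or.inr ⟨1, 1, one_pos, Or.inr (Or.inl rfl)⟩))

theorem sZ_mem : mono 1 0 1 1 ∈ R := by
  have h : mono 1 0 1 1 = mono 1 0 0 0 * mono 0 0 1 1 := by simp [mono_mul]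
  rw [h]
  exact mul_mem (Algebra.subset_adjoin (Or.inl ⟨1, Or.inl rfl⟩))
    (Algebra.subset_adjoin (Or.inr ⟨1, 1, one_pos, Or.inr (Or.inr rfl)⟩))

/-- The element `X * Y * ∏ i, T i` of `R`. -/
noncomputable def sY : R := ⟨mono 1 1 0 1, sY_mem⟩

/-- The element `X * Z * ∏ i, T i` of `R`. -/
noncomputable def sZ : R := ⟨mono 1 0 1 1, sZ_mem⟩

end GLExample

/-!
`R` is the preimage of the constants under the projection `π` of `R₀` onto its part of degree zero
in `X, Y, Z`. Suppose that `r : R` divides a product of two primitive polynomials over `R`. If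
`R₀[X]` is a decomposition monoid, then `r = a * b` in `R₀`, where `a` divides the first polynomial
over `R₀` and `b` the second. If `π a = 0`, then `π` also kills the square root of `a`, which exists
because `𝔽₂` is perfect and exponents can be halved; this root lies in `R` and so does every
multiple of it, which contradicts primitivity. So `π a` and `π b` are nonzero with constant product,
hence constants, which puts `a`, `b` and their cofactors in `R`, and `a` and `b` are units by
primitivity.

That `R₀[X]` is a decomposition monoid follows because its monomials form the cone of nonnegative
elements of a lattice-ordered group `G`. The monoid algebra of `G` itself is a decomposition monoid,
since finitely many of its elements are, up to a common monomial unit, polynomials in finitely many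
indeterminates. To descend to the cone, one multiplies the factors by monomial units. Suitable
exponents exist by lattice interpolation and Gauss's lemma: the infimum of the exponents of a
product is the sum of the infima of the exponents of the factors.

For rational `0 ≤ q ≤ 1`, `s_y` and `s_z` are the products of `X * ∏ i, T i ^ q` with
`Y * ∏ i, T i ^ (1 - q)` and `Z * ∏ i, T i ^ (1 - q)`. The latter two are relatively prime in `R`,
because a common divisor is a monomial free of `X, Y, Z`.
-/

namespace GLExample

theorem exists_mem_upperBounds_inter_lowerBounds {L : Type*} [Lattice L] [Nonempty L]
    {A B : Finset L} (h : ∀ a ∈ A, ∀ b ∈ B, a ≤ b) :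
    ∃ w, w ∈ upperBounds (A : Set L) ∩ lowerBounds (B : Set L) := by
  rcases B.eq_empty_or_nonempty with rfl | hB
  · obtain ⟨w, hw⟩ := A.bddAbove
    exact ⟨w, hw, by simp⟩
  · exact ⟨B.inf' hB id, fun a ha => Finset.le_inf' hB id (h a ha), (B.isGLB_inf' hB).1⟩

theorem twoUniqueSums_of_isAddTorsionFree {G : Type*} [AddCommGroup G] [IsAddTorsionFree G] :
    TwoUniqueSums G :=
  .of_injective_addHom (DivisibleHull.coeAddMonoidHom G : G →ₙ+ DivisibleHull G)
    DivisibleHull.coe_injective inferInstance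

section LatticeOrderedGroup

variable {G : Type*} [AddCommGroup G] [Lattice G] [IsOrderedAddMonoid G]

theorem nonpos_of_isOfFinAddOrder {x : G} (hx : IsOfFinAddOrder x) : x ≤ 0 := by
  obtain ⟨n, hn, hnx⟩ := isOfFinAddOrder_iff_nsmul_eq_zero.1 hx
  let M := (Finset.range n).sup' (Finset.nonempty_range_iff.2 hn.ne') (fun k => k • x)
  have nsmul_le (k : ℕ) : k • x ≤ M := by
    rw [nsmul_eq_mod_nsmul k hnx]
    exact Finset.le_sup' (fun k => k • x) (Finset.mem_range.2 (k.mod_lt hn))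
  have hM : M ≤ M - x := Finset.sup'_le _ _ fun k _ => by
    rw [le_sub_iff_add_le, ← succ_nsmul]
    exact nsmul_le (k + 1)
  rwa [le_sub_self_iff] at hM

theorem isAddTorsionFree_of_lattice : IsAddTorsionFree G :=
  .of_not_isOfFinAddOrder fun _ hx0 hx =>
    hx0 <| (nonpos_of_isOfFinAddOrder hx).antisymm <|
      neg_nonpos.1 (nonpos_of_isOfFinAddOrder hx.neg)

theorem le_add_of_inf_le {u s t α β : G} (hu : u ≤ s + t) (hβ : β ≤ t)
    (hs : (u - β) ⊓ s ≤ α) (ht : (u - α) ⊓ t ≤ β) : u ≤ α + β := by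
  have hle : u - α ≤ t := by
    have h : u - β ≤ (u - β) ⊓ s + (t - β) := by
      rw [inf_add]
      refine le_inf (le_add_of_nonneg_right (sub_nonneg.2 hβ)) ?_
      rw [← add_sub_assoc]
      exact sub_le_sub_right hu β
    have := h.trans (add_le_add_left hs (t - β))
    rw [sub_le_iff_le_add] at this ⊢
    calc u ≤ α + (t - β) + β := this
      _ = t + α := by abel
  rw [inf_eq_left.2 hle] at ht
  rwa [sub_le_iff_le_add'] at ht

end LatticeOrderedGroup

section Gauss

open AddMonoidAlgebra

variable {K G : Type*} [CommRing K] [AddCommGroup G] [Lattice G] [IsOrderedAddMonoid G]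

theorem inf_mem_lowerBounds_support {F H : K[G]} {u a β : G}
    (hu : u ∈ lowerBounds ((F * H).coeff.support : Set G))
    (hβ : IsGLB (H.coeff.support : Set G) β)
    (ih : ∀ v ∈ lowerBounds ((F.erase a * H).coeff.support : Set G),
      ∀ s ∈ (F.erase a).coeff.support, ∀ t ∈ H.coeff.support, v ≤ s + t) :
    (u - β) ⊓ a ∈ lowerBounds (F.coeff.support : Set G) := by
  classical
  intro s hs
  obtain rfl | hsa := eq_or_ne s a
  · exact inf_le_right
  have hsplit : F.erase a * H = F * H - single a (F.coeff a) * H := by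
    rw [← sub_mul, eq_sub_of_add_eq (erase_add_single a F)]
  have hlower : (u - β) ⊓ a + β ∈ lowerBounds ((F.erase a * H).coeff.support : Set G) := by
    intro x hx
    rw [hsplit, coeff_sub] at hx
    rcases Finset.mem_union.1 (Finsupp.support_sub hx) with hx | hx
    · exact (add_le_of_le_sub_right inf_le_left).trans (hu hx)
    · obtain ⟨t, ht, rfl⟩ := Finset.mem_image.1 (support_coeff_single_mul_subset _ _ _ hx)
      exact add_le_add inf_le_right (hβ.1 ht)
  have hs' : s ∈ (F.erase a).coeff.support := by
    rw [coeff_erase, Finsupp.support_erase]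
    exact Finset.mem_erase.2 ⟨hsa, hs⟩
  have hle : (u - β) ⊓ a + β - s ≤ β :=
    hβ.2 fun t ht => sub_le_iff_le_add'.2 (ih _ hlower s hs' t ht)
  rwa [add_sub_right_comm, add_le_iff_nonpos_left, sub_nonpos] at hle

theorem le_add_of_mem_lowerBounds_support_mul [NoZeroDivisors K] {F H : K[G]} {u : G}
    (hu : u ∈ lowerBounds ((F * H).coeff.support : Set G)) {s t : G}
    (hs : s ∈ F.coeff.support) (ht : t ∈ H.coeff.support) : u ≤ s + t := by
  classical
  -- Delete an exponent `a` of `F` or `b` of `H` whose sum is attained only once: by induction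
  -- `le_add_of_inf_le` applies to the infima of the two supports.
  induction hn : F.coeff.support.card + H.coeff.support.card using Nat.strong_induction_on
    generalizing F H u s t with
  | _ n ih =>
  subst hn
  have := isAddTorsionFree_of_lattice (G := G)
  have := twoUniqueSums_of_isAddTorsionFree (G := G)
  obtain ⟨a, ha, b, hb, hab⟩ := UniqueSums.uniqueAdd_of_nonempty ⟨s, hs⟩ ⟨t, ht⟩
  have hua : u ≤ a + b := hu <| Finsupp.mem_support_iff.2 <| by
    rw [coeff_mul_add_of_uniqueAdd hab]
    exact mul_ne_zero (Finsupp.mem_support_iff.1 ha) (Finsupp.mem_support_iff.1 hb)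
  have card_erase_lt {P : K[G]} {x : G} (hx : x ∈ P.coeff.support) :
      (P.erase x).coeff.support.card < P.coeff.support.card := by
    rw [coeff_erase, Finsupp.support_erase]
    exact Finset.card_erase_lt_of_mem hx
  have hα := F.coeff.support.isGLB_inf' ⟨s, hs⟩
  have hβ := H.coeff.support.isGLB_inf' ⟨t, ht⟩
  have hFa := hα.2 <| inf_mem_lowerBounds_support hu hβ fun v hv s hs t ht =>
    ih _ (add_lt_add_left (card_erase_lt ha) _) hv hs ht rfl
  have hHb := hβ.2 <| inf_mem_lowerBounds_support (mul_comm F H ▸ hu) hα fun v hv s hs t ht =>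
    ih _ (by simpa [add_comm] using card_erase_lt hb) hv hs ht rfl
  exact (le_add_of_inf_le hua (hβ.1 hb) hFa hHb).trans (add_le_add (hα.1 hs) (hβ.1 ht))

end Gauss

section TorsionFree

variable {G : Type*} [AddCommGroup G] [IsAddTorsionFree G]

theorem exists_injective_addMonoidHom_finsupp_int (A : Finset G) :
    ∃ (n : ℕ) (φ : (Fin n →₀ ℤ) →+ G), Function.Injective φ ∧ (A : Set G) ⊆ Set.range φ := by
  let H := Submodule.span ℤ (A : Set G)
  have : Module.Finite ℤ H := Module.Finite.span_finset ℤ A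
  let b := Module.finBasis ℤ H
  refine ⟨Module.finrank ℤ H, (H.subtype ∘ₗ b.repr.symm.toLinearMap).toAddMonoidHom,
    H.subtype_injective.comp b.repr.symm.injective, fun x hx => ?_⟩
  exact ⟨b.repr ⟨x, Submodule.subset_span hx⟩, by simp⟩

theorem exists_add_mem_range_natCast {ι : Type*} (A : Finset (ι →₀ ℤ)) :
    ∃ m, ∀ x ∈ A,
      m + x ∈ Set.range (Finsupp.mapRange.addMonoidHom (ι := ι) (Nat.castAddMonoidHom ℤ)) := by
  obtain ⟨l, hl⟩ := A.bddBelow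
  refine ⟨-l, fun x hx => ⟨(-l + x).mapRange Int.toNat rfl, ?_⟩⟩
  ext i
  have := hl hx i
  simp only [Finsupp.mapRange.addMonoidHom_apply, Nat.coe_castAddMonoidHom,
    Finsupp.mapRange_mapRange, Finsupp.mapRange_apply, Finsupp.coe_add, Finsupp.coe_neg,
    Pi.add_apply, Pi.neg_apply, Function.comp_apply, Int.ofNat_toNat]
  omega

theorem exists_injective_addMonoidHom_finsupp_nat (A : Finset G) :
    ∃ (n : ℕ) (φ : (Fin n →₀ ℕ) →+ G) (m : G), Function.Injective φ ∧
      ∀ x ∈ A, m + x ∈ Set.range φ := by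
  obtain ⟨n, φ, hφ, hA⟩ := exists_injective_addMonoidHom_finsupp_int A
  obtain ⟨m, hm⟩ := exists_add_mem_range_natCast (A.preimage φ hφ.injOn)
  refine ⟨n, φ.comp (Finsupp.mapRange.addMonoidHom (Nat.castAddMonoidHom ℤ)), φ m,
    hφ.comp (Finsupp.mapRange_injective _ (map_zero _) Nat.cast_injective), fun x hx => ?_⟩
  obtain ⟨y, rfl⟩ := hA hx
  obtain ⟨k, hk⟩ := hm y (Finset.mem_preimage.2 hx)
  exact ⟨k, by rw [AddMonoidHom.comp_apply, hk, map_add]⟩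

end TorsionFree

theorem exists_dvd_and_dvd_of_units_mul_mem_range {M N : Type*} [CommMonoid M] [CommMonoid N]
    [DecompositionMonoid N] {J : N →* M} (hJ : Function.Injective J) (u : Mˣ) {d e f g : M}
    (hd : u * d ∈ Set.range J) (he : u * e ∈ Set.range J) (hf : u * f ∈ Set.range J)
    (hg : u * g ∈ Set.range J) (h : f * g = d * e) : ∃ a b, a ∣ f ∧ b ∣ g ∧ d = a * b := by
  obtain ⟨d', hd'⟩ := hd
  obtain ⟨e', he'⟩ := he
  obtain ⟨f', hf'⟩ := hf
  obtain ⟨g', hg'⟩ := hg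
  have hdvd : d' ∣ f' * g' := ⟨e', hJ (by
    rw [map_mul, map_mul, hd', he', hf', hg', mul_mul_mul_comm, h, mul_mul_mul_comm])⟩
  obtain ⟨a, b, ⟨a', rfl⟩, ⟨b', rfl⟩, rfl⟩ := exists_dvd_and_dvd_of_dvd_mul hdvd
  refine ⟨↑u⁻¹ * J a, J b, ⟨J a', ?_⟩, ⟨↑u⁻¹ * J b', ?_⟩, ?_⟩
  · rw [mul_assoc, ← map_mul, hf', u.inv_mul_cancel_left]
  · rw [mul_left_comm, ← map_mul, hg', u.inv_mul_cancel_left]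
  · rw [mul_assoc, ← map_mul, hd', u.inv_mul_cancel_left]

section Decomposition

open AddMonoidAlgebra

variable {K G S : Type*} [CommRing K] [AddCommGroup G] [AddCommMonoid S]

theorem single_mul_mem_range_mapDomainRingHom {j : S →+ G} (hj : Function.Injective j) {m : G}
    {F : K[G]} (hF : ∀ x ∈ F.coeff.support, m + x ∈ Set.range j) :
    single m 1 * F ∈ Set.range (mapDomainRingHom K j) := by
  classical
  refine ⟨comapDomain j hj (single m 1 * F), mapDomain_comapDomain (fun s hs => ?_) hj⟩
  obtain ⟨x, hx, rfl⟩ := Finset.mem_image.1 (support_coeff_single_mul_subset _ _ _ hs)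
  exact hF x hx

theorem decompositionMonoid_of_isAddTorsionFree [IsDomain K] [UniqueFactorizationMonoid K]
    [IsAddTorsionFree G] : DecompositionMonoid K[G] := by
  classical
  refine ⟨fun d f g ⟨e, he⟩ => ?_⟩
  obtain ⟨n, φ, m, hφ, hm⟩ := exists_injective_addMonoidHom_finsupp_nat
    (d.coeff.support ∪ e.coeff.support ∪ f.coeff.support ∪ g.coeff.support)
  have : DecompositionMonoid K[Fin n →₀ ℕ] :=
    inferInstanceAs (DecompositionMonoid (MvPolynomial (Fin n) K))
  refine exists_dvd_and_dvd_of_units_mul_mem_range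
    (J := (mapDomainRingHom K φ).toMonoidHom) (mapDomain_injective hφ)
    ((AddMonoidAlgebra.of K G).toHomUnits (.ofAdd m)) ?_ ?_ ?_ ?_ he <;>
  exact single_mul_mem_range_mapDomainRingHom hφ fun x hx => hm x (by simp [hx])

variable [Lattice G] [IsOrderedAddMonoid G]

theorem exists_units_mul_mem_range_mapDomainRingHom [NoZeroDivisors K] {j : S →+ G}
    (hj : Function.Injective j) (hrange : Set.range j = Set.Ici 0) {F F' H H' : K[G]}
    (h₁ : F * H ∈ Set.range (mapDomainRingHom K j))
    (h₂ : F * H' ∈ Set.range (mapDomainRingHom K j))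
    (h₃ : F' * H ∈ Set.range (mapDomainRingHom K j))
    (h₄ : F' * H' ∈ Set.range (mapDomainRingHom K j)) :
    ∃ u : K[G]ˣ, u * F ∈ Set.range (mapDomainRingHom K j) ∧
      u * F' ∈ Set.range (mapDomainRingHom K j) ∧
      ↑u⁻¹ * H ∈ Set.range (mapDomainRingHom K j) ∧
      ↑u⁻¹ * H' ∈ Set.range (mapDomainRingHom K j) := by
  classical
  have neg_le {P Q : K[G]} (h : P * Q ∈ Set.range (mapDomainRingHom K j)) :
      ∀ s ∈ P.coeff.support, ∀ t ∈ Q.coeff.support, -s ≤ t := by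
    obtain ⟨p, hp⟩ := h
    refine fun s hs t ht => neg_le_iff_add_nonneg'.2 ?_
    refine le_add_of_mem_lowerBounds_support_mul (fun x hx => ?_) hs ht
    rw [← hp] at hx
    obtain ⟨y, -, rfl⟩ := Finset.mem_image.1 (Finsupp.mapDomain_support hx)
    exact hrange.subset ⟨y, rfl⟩
  obtain ⟨w, hF, hH⟩ := exists_mem_upperBounds_inter_lowerBounds
    (A := (F.coeff.support ∪ F'.coeff.support).image (-·))
    (B := H.coeff.support ∪ H'.coeff.support) (by
      simp only [Finset.mem_image, Finset.mem_union, forall_exists_index, and_imp]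
      rintro _ s hs rfl t ht
      rcases hs with hs | hs <;> rcases ht with ht | ht
      exacts [neg_le h₁ s hs t ht, neg_le h₂ s hs t ht, neg_le h₃ s hs t ht, neg_le h₄ s hs t ht])
  have hF' (s) (hs : s ∈ F.coeff.support ∪ F'.coeff.support) : w + s ∈ Set.range j :=
    hrange.superset (neg_le_iff_add_nonneg.1 (hF (Finset.mem_image_of_mem _ hs)))
  have hH' (t) (ht : t ∈ H.coeff.support ∪ H'.coeff.support) : -w + t ∈ Set.range j :=
    hrange.superset (le_neg_add_iff_le.2 (hH ht))
  refine ⟨(AddMonoidAlgebra.of K G).toHomUnits (.ofAdd w), ?_, ?_, ?_, ?_⟩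
  · exact single_mul_mem_range_mapDomainRingHom hj fun s hs => hF' s (by simp [hs])
  · exact single_mul_mem_range_mapDomainRingHom hj fun s hs => hF' s (by simp [hs])
  · exact single_mul_mem_range_mapDomainRingHom hj fun s hs => hH' s (by simp [hs])
  · exact single_mul_mem_range_mapDomainRingHom hj fun s hs => hH' s (by simp [hs])

theorem decompositionMonoid_of_range_eq_Ici [IsDomain K] [UniqueFactorizationMonoid K]
    {j : S →+ G} (hj : Function.Injective j) (hrange : Set.range j = Set.Ici 0) :
    DecompositionMonoid K[S] := by
  have := isAddTorsionFree_of_lattice (G := G)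
  have := twoUniqueSums_of_isAddTorsionFree (G := G)
  have := decompositionMonoid_of_isAddTorsionFree (K := K) (G := G)
  let J := mapDomainRingHom K j
  have hJ : Function.Injective J := mapDomain_injective hj
  refine ⟨fun d f g ⟨e, he⟩ => ?_⟩
  obtain rfl | hf := eq_or_ne f 0
  · exact ⟨d, 1, dvd_zero d, one_dvd g, (mul_one d).symm⟩
  obtain rfl | hg := eq_or_ne g 0
  · exact ⟨1, d, one_dvd f, dvd_zero d, (one_mul d).symm⟩
  have hE : J f * J g = J d * J e := by rw [← map_mul, he, map_mul]
  obtain ⟨D₁, D₂, ⟨H₁, hf'⟩, ⟨H₂, hg'⟩, hd'⟩ := exists_dvd_and_dvd_of_dvd_mul (Dvd.intro _ hE.symm)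
  have hd0 : J d ≠ 0 := left_ne_zero_of_mul (b := J e) <| hE ▸
    mul_ne_zero ((map_ne_zero_iff J hJ).2 hf) ((map_ne_zero_iff J hJ).2 hg)
  have he' : J e = H₂ * H₁ := by
    refine mul_left_cancel₀ hd0 ?_
    rw [← hE, hf', hg', hd']
    ring
  obtain ⟨u, ⟨d₁, hd₁⟩, ⟨h₂, hh₂⟩, ⟨d₂, hd₂⟩, ⟨h₁, hh₁⟩⟩ :=
    exists_units_mul_mem_range_mapDomainRingHom hj hrange (K := K) (F := D₁) (F' := H₂)
      (H := D₂) (H' := H₁) ⟨d, hd'⟩ ⟨f, hf'⟩ ⟨g, hg'.trans (mul_comm _ _)⟩ ⟨e, he'⟩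
  have cancel {p q P Q} (hp : J p = u * P) (hq : J q = ↑u⁻¹ * Q) : J (p * q) = P * Q := by
    rw [map_mul, hp, hq, mul_mul_mul_comm, u.mul_inv, one_mul]
  refine ⟨d₁, d₂, ⟨h₁, hJ ?_⟩, ⟨h₂, hJ ?_⟩, hJ ?_⟩
  · rw [hf', cancel hd₁ hh₁]
  · rw [hg', mul_comm d₂, cancel hh₂ hd₂, mul_comm]
  · rw [hd', cancel hd₁ hd₂]

end Decomposition

section Pullback

open Polynomial

theorem exists_C_dvd_and_C_dvd_of_C_dvd_mul {A : Type*} [CommRing A] [IsDomain A]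
    [DecompositionMonoid A[X]] {f g : A[X]} {r : A} (hr : r ≠ 0) (h : C r ∣ f * g) :
    ∃ a b, C a ∣ f ∧ C b ∣ g ∧ r = a * b := by
  obtain ⟨p, q, hp, hq, hpq⟩ := exists_dvd_and_dvd_of_dvd_mul h
  have hpq0 : p * q ≠ 0 := hpq ▸ C_ne_zero.2 hr
  have hdeg := natDegree_mul (left_ne_zero_of_mul hpq0) (right_ne_zero_of_mul hpq0)
  rw [← hpq, natDegree_C] at hdeg
  obtain ⟨a, rfl⟩ := natDegree_eq_zero.1 (by omega : p.natDegree = 0)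
  obtain ⟨b, rfl⟩ := natDegree_eq_zero.1 (by omega : q.natDegree = 0)
  exact ⟨a, b, hp, hq, C_injective (hpq.trans C_mul.symm)⟩

variable {k A B : Type*} [CommRing k] [CommRing A] [CommRing B] [Algebra k A] [Algebra k B]
  {π : A →ₐ[k] B} {S : Subalgebra k B}

theorem C_dvd_of_coeff_eq_mul {f : (S.comap π)[X]} {d : S.comap π} {h : ℕ → A}
    (hmem : ∀ i, π (h i) ∈ S) (hf : ∀ i, (f.coeff i : A) = d * h i) : C d ∣ f :=
  (C_dvd_iff_dvd_coeff d f).2 fun i => ⟨⟨h i, hmem i⟩, Subtype.ext (hf i)⟩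

theorem map_ne_zero_of_C_dvd_map [Nontrivial B]
    (hπ : ∀ d, π d = 0 → ∃ d₁ d₂, π d₁ = 0 ∧ π d₂ = 0 ∧ d = d₁ * d₂)
    {f : (S.comap π)[X]} (hf : f.IsPrimitive) {d : A}
    (hd : C d ∣ f.map (algebraMap (S.comap π) A)) : π d ≠ 0 := by
  intro hd0
  obtain ⟨d₁, d₂, h₁, h₂, rfl⟩ := hπ d hd0
  choose h hh using (C_dvd_iff_dvd_coeff _ _).1 hd
  have hdvd : C (⟨d₁, by simp [h₁]⟩ : S.comap π) ∣ f :=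
    C_dvd_of_coeff_eq_mul (h := fun i => d₂ * h i) (by simp [h₂]) fun i =>
      (coeff_map _ i).symm.trans ((hh i).trans (mul_assoc _ _ _))
  have hu := ((hf _ hdvd).map (S.comap π).val).map π
  exact not_isUnit_zero (h₁ ▸ hu)

theorem isUnit_of_C_dvd_map [NoZeroDivisors B] (hS : ∀ x y, x * y ∈ S → x * y ≠ 0 → x ∈ S)
    {f : (S.comap π)[X]} (hf : f.IsPrimitive) {d : S.comap π}
    (hd0 : π d ≠ 0) (hd : C (d : A) ∣ f.map (algebraMap (S.comap π) A)) :
    IsUnit d := by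
  choose h hh using (C_dvd_iff_dvd_coeff _ _).1 hd
  simp only [coeff_map] at hh
  refine hf d (C_dvd_of_coeff_eq_mul (fun i => ?_) hh)
  obtain h0 | h0 := eq_or_ne (π (h i)) 0
  · exact h0 ▸ zero_mem S
  · refine hS (π (h i)) (π d) ?_ (mul_ne_zero h0 hd0)
    rw [mul_comm, ← map_mul, ← hh i]
    exact (f.coeff i).2

theorem isGLDomain_comap [IsDomain A] [IsDomain B] [DecompositionMonoid A[X]]
    (hS : ∀ x y, x * y ∈ S → x * y ≠ 0 → x ∈ S)
    (hπ : ∀ d, π d = 0 → ∃ d₁ d₂, π d₁ = 0 ∧ π d₂ = 0 ∧ d = d₁ * d₂) :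
    IsGLDomain (S.comap π) := by
  refine ⟨inferInstance, fun f g hf hg r hr => ?_⟩
  have hr0 : r ≠ 0 := fun h =>
    mul_ne_zero hf.ne_zero hg.ne_zero (zero_dvd_iff.1 (by rwa [h, C_0] at hr))
  have hdvd := Polynomial.map_dvd (algebraMap (S.comap π) A) hr
  rw [Polynomial.map_mul, map_C] at hdvd
  obtain ⟨a, b, ha, hb, hab⟩ := exists_C_dvd_and_C_dvd_of_C_dvd_mul
    ((map_ne_zero_iff _ (FaithfulSMul.algebraMap_injective (S.comap π) A)).2 hr0) hdvd
  have ha0 := map_ne_zero_of_C_dvd_map hπ hf ha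
  have hb0 := map_ne_zero_of_C_dvd_map hπ hg hb
  have hmem : π a * π b ∈ S := by
    rw [← map_mul, ← hab]
    exact r.2
  have haS : π a ∈ S := hS _ _ hmem (mul_ne_zero ha0 hb0)
  rw [mul_comm] at hmem
  have hbS : π b ∈ S := hS _ _ hmem (mul_ne_zero hb0 ha0)
  have hua := isUnit_of_C_dvd_map (d := ⟨a, haS⟩) hS hf ha0 ha
  have hub := isUnit_of_C_dvd_map (d := ⟨b, hbS⟩) hS hg hb0 hb
  have hr' : r = ⟨a, haS⟩ * ⟨b, hbS⟩ := Subtype.ext hab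
  exact hr' ▸ hua.mul hub

end Pullback

section PolynomialDecomposition

open Polynomial

/-- The embedding of the exponent vectors of `R₀[X]` as the nonnegative elements of a
lattice-ordered group; the first coordinate is the exponent of the polynomial variable. -/
def exponentEmbedding : ℕ × (Var → ℚ≥0) →+ ℤ × (Var → ℚ) where
  toFun p := (p.1, fun i => p.2 i)
  map_zero' := by ext <;> simp
  map_add' p q := by ext <;> simp

theorem exponentEmbedding_injective : Function.Injective exponentEmbedding := by
  intro p q h
  rw [Prod.ext_iff] at h
  exact Prod.ext (Nat.cast_injective h.1) (funext fun i => NNRat.cast_injective (congrFun h.2 i))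

theorem range_exponentEmbedding : Set.range exponentEmbedding = Set.Ici 0 := by
  refine Set.Subset.antisymm ?_ fun g hg => ?_
  · rintro _ ⟨p, rfl⟩
    exact ⟨Int.natCast_nonneg p.1, fun i => (p.2 i).2⟩
  · exact ⟨(g.1.toNat, fun i => ⟨g.2 i, hg.2 i⟩), Prod.ext (Int.toNat_of_nonneg hg.1) rfl⟩

theorem decompositionMonoid_polynomial : DecompositionMonoid R₀[X] := by
  have : DecompositionMonoid (AddMonoidAlgebra (ZMod 2) (ℕ × (Var → ℚ≥0))) :=
    decompositionMonoid_of_range_eq_Ici exponentEmbedding_injective range_exponentEmbedding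
  exact MulEquiv.decompositionMonoid
    ((toFinsuppIso R₀).trans (AddMonoidAlgebra.curryRingEquiv (R := ZMod 2)).symm)

end PolynomialDecomposition

section Monomials

open AddMonoidAlgebra

theorem eq_single_of_mul_eq_single {K S : Type*} [Semiring K] [NoZeroDivisors K] [Add S]
    [TwoUniqueSums S] {f g : K[S]} {s : S} {r : K} (hr : r ≠ 0) (h : f * g = single s r) :
    ∃ a b c d, f = single a c ∧ g = single b d ∧ a + b = s ∧ c ≠ 0 := by
  classical
  have hfg : f * g ≠ 0 := h ▸ single_ne_zero.2 hr
  have nonempty {p : K[S]} (hp : p ≠ 0) : p.coeff.support.Nonempty := by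
    simpa [Finsupp.support_nonempty_iff] using hp
  have hf := nonempty (left_ne_zero_of_mul hfg)
  have hg := nonempty (right_ne_zero_of_mul hfg)
  have add_eq {a} (ha : a ∈ f.coeff.support) {b} (hb : b ∈ g.coeff.support)
      (hu : UniqueAdd f.coeff.support g.coeff.support a b) : a + b = s := by
    by_contra hne
    have h1 := coeff_mul_add_of_uniqueAdd hu
    rw [h, coeff_single, Finsupp.single_eq_of_ne hne] at h1
    exact mul_ne_zero (Finsupp.mem_support_iff.1 ha) (Finsupp.mem_support_iff.1 hb) h1.symm
  have hcard : f.coeff.support.card * g.coeff.support.card ≤ 1 := by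
    by_contra! hlt
    obtain ⟨p, hp, q, hq, hne, hup, huq⟩ := TwoUniqueSums.uniqueAdd_of_one_lt_card hlt
    rw [Finset.mem_product] at hp hq
    obtain ⟨h₁, h₂⟩ := hup hq.1 hq.2 ((add_eq hq.1 hq.2 huq).trans (add_eq hp.1 hp.2 hup).symm)
    exact hne (Prod.ext h₁.symm h₂.symm)
  obtain ⟨hf1, hg1⟩ := mul_eq_one.1
    (hcard.antisymm (Nat.mul_pos hf.card_pos hg.card_pos))
  obtain ⟨a, c, hc, hfa⟩ := Finsupp.card_support_eq_one'.1 hf1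
  obtain ⟨b, d, -, hgb⟩ := Finsupp.card_support_eq_one'.1 hg1
  obtain rfl : f = single a c := coeff_injective (hfa.trans (coeff_single _ _).symm)
  obtain rfl : g = single b d := coeff_injective (hgb.trans (coeff_single _ _).symm)
  rw [single_mul_single] at h
  exact ⟨a, b, c, d, rfl, rfl, ((single_inj.1 h).resolve_right fun h' => hr h'.2).1, hc⟩

theorem exists_eq_single_of_dvd_single {K S : Type*} [Semiring K] [NoZeroDivisors K] [AddMonoid S]
    [LE S] [CanonicallyOrderedAdd S] [TwoUniqueSums S] {f : K[S]} {s : S} {r : K} (hr : r ≠ 0)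
    (h : f ∣ single s r) : ∃ a ≤ s, ∃ c ≠ 0, f = single a c := by
  obtain ⟨g, hg⟩ := h
  obtain ⟨a, b, c, d, rfl, -, rfl, hc⟩ := eq_single_of_mul_eq_single hr hg.symm
  exact ⟨a, le_self_add, c, hc, rfl⟩

theorem surjective_pow_of_surjective_nsmul {K S : Type*} [CommSemiring K] [AddCommMonoid S] (p : ℕ)
    [Fact p.Prime] [CharP K p] [PerfectRing K p]
    (hS : Function.Surjective fun s : S => p • s) : Function.Surjective fun f : K[S] => f ^ p := by
  have : CharP K[S] p :=
    charP_of_injective_algebraMap (FaithfulSMul.algebraMap_injective K K[S]) p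
  intro f
  induction f using AddMonoidAlgebra.induction_linear with
  | zero => exact ⟨0, zero_pow (Fact.out : p.Prime).ne_zero⟩
  | add f g hf hg =>
    obtain ⟨a, rfl⟩ := hf
    obtain ⟨b, rfl⟩ := hg
    exact ⟨a + b, add_pow_char a b p⟩
  | single s r =>
    obtain ⟨t, rfl⟩ := hS s
    obtain ⟨q, rfl⟩ := surjective_frobenius K p r
    exact ⟨single t q, single_pow _ _ _⟩

theorem mem_bot_iff_support_subset {K S : Type*} [CommSemiring K] [AddMonoid S] {f : K[S]} :
    f ∈ (⊥ : Subalgebra K K[S]) ↔ ∀ s ∈ f.coeff.support, s = 0 := by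
  rw [Algebra.mem_bot]
  refine ⟨?_, fun h => ⟨f.coeff 0, coeff_injective ?_⟩⟩
  · rintro ⟨r, rfl⟩ s hs
    exact Finset.mem_singleton.1 (Finsupp.support_single_subset hs)
  · exact (Finsupp.support_subset_singleton.1 fun s hs => Finset.mem_singleton.2 (h s hs)).symm

variable {K S : Type*} [CommSemiring K] [AddCommMonoid S]

theorem mem_bot_of_mul_mem_bot [NoZeroDivisors K] [TwoUniqueSums S] [Subsingleton (AddUnits S)]
    {f g : K[S]} (h : f * g ∈ (⊥ : Subalgebra K K[S])) (h0 : f * g ≠ 0) :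
    f ∈ (⊥ : Subalgebra K K[S]) := by
  obtain ⟨r, hr⟩ := Algebra.mem_bot.1 h
  have hr0 : r ≠ 0 := fun h => h0 (by rw [← hr, h, map_zero])
  obtain ⟨a, b, c, d, rfl, rfl, hab, -⟩ := eq_single_of_mul_eq_single hr0 hr.symm
  exact Algebra.mem_bot.2 ⟨c, by rw [(add_eq_zero.1 hab).1]; rfl⟩

variable {M : Type*} [AddCommMonoid M] [Subsingleton (AddUnits M)]

open Classical in
/-- The projection of `K[S]`, graded by `δ`, onto its part of degree zero. It is multiplicative
because a sum of degrees vanishes only when both summands do. -/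
noncomputable def degreeZeroPart (δ : S →+ M) : K[S] →ₐ[K] K[S] :=
  AddMonoidAlgebra.lift K K[S] S
    { toFun s := if δ s.toAdd = 0 then single s.toAdd 1 else 0
      map_one' := by simp [one_def]
      map_mul' s t := by
        by_cases hs : δ s.toAdd = 0 <;> by_cases ht : δ t.toAdd = 0 <;>
          simp [hs, ht, single_mul_single] }

open Classical in
theorem degreeZeroPart_single (δ : S →+ M) (s : S) (r : K) :
    degreeZeroPart δ (single s r) = if δ s = 0 then single s r else 0 := by
  simp [degreeZeroPart]

open Classical in
theorem coeff_degreeZeroPart (δ : S →+ M) (f : K[S]) (s : S) :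
    (degreeZeroPart δ f).coeff s = if δ s = 0 then f.coeff s else 0 := by
  induction f using AddMonoidAlgebra.induction_linear with
  | zero => simp
  | add f g hf hg => rw [map_add, coeff_add, Finsupp.add_apply, hf, hg]; split_ifs <;> simp
  | single t r =>
    rw [degreeZeroPart_single]
    obtain rfl | hts := eq_or_ne t s
    · split_ifs <;> simp
    · split_ifs <;> simp [hts]

theorem degreeZeroPart_mem_bot_iff {δ : S →+ M} {f : K[S]} :
    degreeZeroPart δ f ∈ (⊥ : Subalgebra K K[S]) ↔ ∀ s ∈ f.coeff.support, δ s = 0 → s = 0 := by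
  simp only [mem_bot_iff_support_subset, Finsupp.mem_support_iff, coeff_degreeZeroPart, ne_eq,
    ite_eq_right_iff, Classical.not_imp, and_imp]
  exact ⟨fun h s hs hδ => h s hδ hs, fun h s hδ hs => h s hs hδ⟩

end Monomials

section PullbackDescription

open AddMonoidAlgebra

/-- The total degree of an exponent vector in the indeterminates `X, Y, Z`: the elements of `R`
are those whose part of degree zero for this grading is constant. -/
def xyzDegree : (Var → ℚ≥0) →+ ℚ≥0 where
  toFun s := s Var.X + s Var.Y + s Var.Z
  map_zero' := by simp
  map_add' s t := by simp only [Pi.add_apply]; abel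

theorem xyzDegree_eq_zero_iff {s : Var → ℚ≥0} :
    xyzDegree s = 0 ↔ s Var.X = 0 ∧ s Var.Y = 0 ∧ s Var.Z = 0 := by
  change s Var.X + s Var.Y + s Var.Z = 0 ↔ _
  rw [add_eq_zero, add_eq_zero, and_assoc]

theorem mono_ne_zero (a b c : ℚ≥0) (t : ℕ+ → ℚ≥0) : mono a b c t ≠ 0 :=
  single_ne_zero.2 one_ne_zero

theorem mono_mem_R {a b c : ℚ≥0} {t : ℕ+ → ℚ≥0} (h : a = 0 → b = 0 → c = 0 → t = 0) :
    mono a b c t ∈ R := by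
  have pure {m} (hm : m ∈ pureGenerators) : m ∈ R := Algebra.subset_adjoin (.inl hm)
  have mixed {m} (hm : m ∈ mixedGenerators) : m ∈ R := Algebra.subset_adjoin (.inr hm)
  have hX : mono a 0 0 0 ∈ R := pure ⟨a, .inl rfl⟩
  have hY : mono 0 b 0 0 ∈ R := pure ⟨b, .inr (.inl rfl)⟩
  have hZ : mono 0 0 c 0 ∈ R := pure ⟨c, .inr (.inr rfl)⟩
  obtain ha | ha := eq_or_ne a 0
  · obtain hb | hb := eq_or_ne b 0
    · obtain hc | hc := eq_or_ne c 0
      · rw [h ha hb hc]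
        simpa [mono_mul] using mul_mem (mul_mem hX hY) hZ
      · have hZT := mixed ⟨c, t, pos_iff_ne_zero.2 hc, .inr (.inr rfl)⟩
        simpa [mono_mul] using mul_mem (mul_mem hX hY) hZT
    · have hYT := mixed ⟨b, t, pos_iff_ne_zero.2 hb, .inr (.inl rfl)⟩
      simpa [mono_mul] using mul_mem (mul_mem hX hYT) hZ
  · have hXT := mixed ⟨a, t, pos_iff_ne_zero.2 ha, .inl rfl⟩
    simpa [mono_mul] using mul_mem (mul_mem hXT hY) hZ

theorem R_eq_comap : R = (⊥ : Subalgebra (ZMod 2) R₀).comap (degreeZeroPart xyzDegree) := by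
  refine le_antisymm (Algebra.adjoin_le ?_) fun f hf => ?_
  · have mono_mem {a b c t} (h : a = 0 → b = 0 → c = 0 → t = 0) :
        degreeZeroPart xyzDegree (mono a b c t) ∈ (⊥ : Subalgebra (ZMod 2) R₀) := by
      refine degreeZeroPart_mem_bot_iff.2 fun s hs hdeg => ?_
      obtain rfl := Finset.mem_singleton.1 (Finsupp.support_single_subset hs)
      obtain ⟨ha, hb, hc⟩ := xyzDegree_eq_zero_iff.1 hdeg
      funext v
      cases v
      exacts [ha, hb, hc, congrFun (h ha hb hc) _]
    rintro _ (⟨α, rfl | rfl | rfl⟩ | ⟨α, t, hα, rfl | rfl | rfl⟩)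
    · exact mono_mem fun _ _ _ => rfl
    · exact mono_mem fun _ _ _ => rfl
    · exact mono_mem fun _ _ _ => rfl
    · exact mono_mem fun h => absurd h hα.ne'
    · exact mono_mem fun _ h => absurd h hα.ne'
    · exact mono_mem fun _ _ h => absurd h hα.ne'
  · rw [← sum_coeff_single f]
    refine sum_mem fun s hs => ?_
    have hexpo : expo (s Var.X) (s Var.Y) (s Var.Z) (fun i => s (Var.T i)) = s := by
      funext v
      cases v <;> rfl
    have hmono : single s (f.coeff s) =
        f.coeff s • mono (s Var.X) (s Var.Y) (s Var.Z) fun i => s (Var.T i) := by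
      rw [mono, hexpo, smul_single, smul_eq_mul, mul_one]
    rw [hmono]
    refine R.smul_mem (mono_mem_R fun hX hY hZ => ?_) _
    rw [degreeZeroPart_mem_bot_iff.1 hf s hs (xyzDegree_eq_zero_iff.2 ⟨hX, hY, hZ⟩)]
    rfl

theorem eq_zero_of_mem_support {f : R₀} (hf : f ∈ R) {s : Var → ℚ≥0} (hs : s ∈ f.coeff.support)
    (hdeg : xyzDegree s = 0) : s = 0 := by
  rw [R_eq_comap] at hf
  exact degreeZeroPart_mem_bot_iff.1 hf s hs hdeg

theorem isGLDomain_R : IsGLDomain R := by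
  have := decompositionMonoid_polynomial
  rw [R_eq_comap]
  refine isGLDomain_comap (fun _ _ => mem_bot_of_mul_mem_bot) fun d hd => ?_
  obtain ⟨e, rfl⟩ := surjective_pow_of_surjective_nsmul (K := ZMod 2) 2
    (fun s : Var → ℚ≥0 => ⟨fun i => s i / 2, funext fun i => (two_nsmul _).trans (add_halves _)⟩) d
  rw [map_pow, sq_eq_zero_iff] at hd
  exact ⟨e, e, hd, hd, sq e⟩

end PullbackDescription

section MaximalCommonDivisors

open AddMonoidAlgebra

theorem isMCD_of_isRelPrime {M : Type*} [CommMonoidWithZero M] [IsCancelMulZero M] {d y z : M}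
    (hd : d ≠ 0) (h : IsRelPrime y z) : IsMCD {d * y, d * z} d := by
  refine ⟨by rintro _ (rfl | rfl) <;> exact dvd_mul_right _ _, ?_⟩
  rintro _ hd' ⟨w, rfl⟩
  have hy : w ∣ y := (mul_dvd_mul_iff_left hd).1 (hd' _ (.inl rfl))
  have hz : w ∣ z := (mul_dvd_mul_iff_left hd).1 (hd' _ (.inr rfl))
  exact associated_mul_unit_right d w (h hy hz)

theorem isRelPrime_mono {b c : ℚ≥0} {t u : ℕ+ → ℚ≥0} (hb : mono 0 b 0 t ∈ R)
    (hc : mono 0 0 c u ∈ R) : IsRelPrime (⟨mono 0 b 0 t, hb⟩ : R) ⟨mono 0 0 c u, hc⟩ := by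
  intro d hdy hdz
  obtain ⟨a, ha, r, hr, hd⟩ := exists_eq_single_of_dvd_single one_ne_zero (map_dvd R.val hdy)
  obtain ⟨a', ha', r', -, hd'⟩ := exists_eq_single_of_dvd_single one_ne_zero (map_dvd R.val hdz)
  obtain rfl : a = a' := ((single_inj.1 (hd.symm.trans hd')).resolve_right fun h => hr h.1).1
  have hdeg : xyzDegree a = 0 := xyzDegree_eq_zero_iff.2
    ⟨nonpos_iff_eq_zero.1 (ha Var.X), nonpos_iff_eq_zero.1 (ha' Var.Y),
      nonpos_iff_eq_zero.1 (ha Var.Z)⟩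
  have haR : a ∈ (d : R₀).coeff.support := by
    rw [← R.coe_val, hd, coeff_single]
    exact (Finsupp.mem_support_single _ _ _).2 ⟨rfl, hr⟩
  obtain rfl := eq_zero_of_mem_support d.2 haR hdeg
  have hdr : d = algebraMap (ZMod 2) R r := Subtype.ext hd
  exact hdr ▸ hr.isUnit.map (algebraMap (ZMod 2) R)

/-- The element `X * ∏ i, T i ^ q` of `R`, a maximal common divisor of `sY` and `sZ` when
`q ≤ 1`. -/
noncomputable def xT (q : ℚ≥0) : R :=
  ⟨mono 1 0 0 fun _ => q, mono_mem_R fun h => absurd h one_ne_zero⟩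

theorem isMCD_xT {q : ℚ≥0} (hq : q ≤ 1) : IsMCD {sY, sZ} (xT q) := by
  obtain ⟨p, hp⟩ := exists_add_of_le hq
  have hqp : (fun _ => q) + (fun _ => p) = (1 : ℕ+ → ℚ≥0) := funext fun _ => hp.symm
  let y : R := ⟨mono 0 1 0 fun _ => p, mono_mem_R fun _ h => absurd h one_ne_zero⟩
  let z : R := ⟨mono 0 0 1 fun _ => p, mono_mem_R fun _ _ h => absurd h one_ne_zero⟩
  have hy : sY = xT q * y := Subtype.ext (by simp [sY, xT, y, mono_mul, hqp])
  have hz : sZ = xT q * z := Subtype.ext (by simp [sZ, xT, z, mono_mul, hqp])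
  rw [hy, hz]
  exact isMCD_of_isRelPrime (fun h => mono_ne_zero _ _ _ _ (congrArg Subtype.val h))
    (isRelPrime_mono _ _)

theorem le_of_xT_dvd_xT {q q' : ℚ≥0} (h : xT q ∣ xT q') : q ≤ q' := by
  obtain ⟨a, ha, r, -, hr⟩ := exists_eq_single_of_dvd_single one_ne_zero (map_dvd R.val h)
  obtain rfl := ((single_inj.1 hr).resolve_right fun h => one_ne_zero h.1).1
  exact ha (Var.T 1)

theorem infinite_mcdClasses : (mcdClasses ({sY, sZ} : Set R)).Infinite := by
  refine ((Set.Icc_infinite zero_lt_one).image (f := fun q => Associates.mk (xT q)) ?_).mono ?_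
  · intro q _ q' _ h
    have h' := Associates.mk_eq_mk_iff_associated.1 h
    exact le_antisymm (le_of_xT_dvd_xT h'.dvd) (le_of_xT_dvd_xT h'.symm.dvd)
  · rintro _ ⟨q, hq, rfl⟩
    exact ⟨xT q, isMCD_xT hq.2, rfl⟩

theorem not_isMCDFinite_R : ¬ IsMCDFinite R := by
  intro h
  refine infinite_mcdClasses (h {sY, sZ} (Set.toFinite _) (Set.insert_nonempty _ _) ?_)
  rintro (h0 | h0) <;> exact mono_ne_zero _ _ _ _ (congrArg Subtype.val h0).symm

end MaximalCommonDivisors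

end GLExample

theorem mainTheorem4 :
    GLExample.IsGLDomain GLExample.R ∧
      ¬ GLExample.IsMCDFinite GLExample.R ∧
      (GLExample.mcdClasses ({GLExample.sY, GLExample.sZ} : Set GLExample.R)).Infinite :=
  ⟨GLExample.isGLDomain_R, GLExample.not_isMCDFinite_R, GLExample.infinite_mcdClasses⟩
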